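/- Let $p$ be a prime, $k$ a perfect field of characteristic $p$, $n\ge 1$, $R=k[[X_1,\dots,X_{n+1}]]$ with maximal ideal $\mathfrak m=(X_1,\dots,X_{n+1})$, and $0\ne f\in\mathfrak m$. For a ring $A$ of characteristic $p$ let $F^e_*A$ be $A$ viewed as an $A$-module via the $e$-th iterated Frobenius, so that $a\cdot F^e_*(s)=F^e_*(a^{p^e}s)$; for $g\in A$ let $F^e_*(g):F^e_*A\to F^e_*A$ be the $A$-linear map $F^e_*(s)\mapsto F^e_*(gs)$. Put $$M_{e,t}=\frac{(f^t)+\mathfrak m^{[p^e]}}{(f^{t+1})+\mathfrak m^{[p^e]}},\qquad \mathfrak m^{[p^e]}=(a^{p^e}\mid a\in\mathfrak m),\qquad C_{e,t}=\frac{\ell_R(M_{e,t})}{p^{en}},$$ and for $x\in[0,1]$ put $\xi_f(x)=\limsup_{e\to\infty}\xi_{f,e}(x)$, where $\xi_{f,e}(x)=C_{e,\lfloor xp^e\rfloor}$ for $x<1$ and $\xi_{f,e}(1)=C_{e,p^e-1}$. A matrix factorization of $f$ is a pair of $R$-linear maps $\rho:G\to F$, $\sigma:F\to G$ between finitely generated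 free $R$-modules of equal rank with $\rho\sigma=f\cdot\mathrm{id}_F$ and $\sigma\rho=f\cdot\mathrm{id}_G$; it is reduced if all entries of the matrices of $\rho$ and $\sigma$ lie in $\mathfrak m$. For a $d$-dimensional ring $A$ of characteristic $p$, the F-signature is $s(A)=\lim_{e\to\infty}a_e/p^{ed}$, where $F^e_*A\cong A^{a_e}\oplus M_e$ and $M_e$ has no nonzero free direct summand. Then the following hold. (1) For every integer $e\ge 0$, $(F^e_*(f),F^e_*(f^{p^e-1}))$, as a pair of endomorphisms of $F^e_*R$, is a matrix factorization of $f$, and it has a decomposition $$(F^e_*(f),F^e_*(f^{p^e-1}))\cong (f,\mathrm{id}_R)^{\oplus v_e}\oplus(\mathrm{id}_R,f)^{\oplus u_e}\oplus(\gamma_1,\gamma_2)$$ with $(\gamma_1,\gamma_2)$ a reduced matrix factorization of $f$. (2) In every such decomposition, $v_e=\ell_R(M_{e,p^e-1})$. (3) In every such decomposition, $v_e$ is the free rank of $F^e_*(R/(f))$ over $R/(f)$: it is the unique integer $a$ such that $F^e_*(R/(f))\cong (R/(f))^{a}\oplus N$ with $N$ having no nonzero free direct summand, and it is the largest rank of a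 free $R/(f)$-module that is a direct summand of $F^e_*(R/(f))$. (4) The F-signature of $R/(f)$ and the limit of $\ell_R(M_{e,p^e-1})/p^{en}$ as $e\to\infty$ both exist, and $$s(R/(f))=\lim_{e\to\infty}\frac{\ell_R(M_{e,p^e-1})}{p^{en}}=\xi_f(1).$$ -/

import Mathlib

open Filter Topology

/-! ### Frobenius push-forward -/

/-- `F^e_* A`: the additive group of `A`, made into an `A`-module by restriction of scalars along
the `e`-th iterate of the Frobenius endomorphism. -/
def FrobPush (_p _e : ℕ) (A : Type*) : Type _ := A

namespace FrobPush

instance (p e : ℕ) (A : Type*) [CommRing A] : AddCommGroup (FrobPush p e A) :=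
  inferInstanceAs (AddCommGroup A)

/-- The element `F^e_*(s)` attached to `s : A`. -/
def of (p e : ℕ) (A : Type*) [CommRing A] : A ≃+ FrobPush p e A := AddEquiv.refl A

noncomputable instance (p e : ℕ) (A : Type*) [CommRing A] [Fact p.Prime] [CharP A p] :
    Module A (FrobPush p e A) :=
  Module.compHom A (iterateFrobenius A p e)

theorem smul_of (p e : ℕ) (A : Type*) [CommRing A] [Fact p.Prime] [CharP A p] (a s : A) :
    a • of p e A s = of p e A (a ^ p ^ e * s) := rfl

/-- The `A`-linear map `F^e_*(g) : F^e_* A → F^e_* A`, `F^e_*(s) ↦ F^e_*(g s)`. -/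
noncomputable def mul (p e : ℕ) {A : Type*} [CommRing A] [Fact p.Prime] [CharP A p] (g : A) :
    FrobPush p e A →ₗ[A] FrobPush p e A where
  toFun x := of p e A (g * (of p e A).symm x)
  map_add' x y := by simp [mul_add]
  map_smul' a x := by
    obtain ⟨s, rfl⟩ := (of p e A).surjective x
    simp [smul_of, mul_left_comm]

end FrobPush

/-! ### Characteristic of power series rings and of their quotients -/

instance MvPowerSeries.instCharPOfCoeff (p : ℕ) (σ k : Type*) [CommRing k] [CharP k p] :
    CharP (MvPowerSeries σ k) p :=
  charP_of_injective_ringHom (f := (MvPowerSeries.C : k →+* MvPowerSeries σ k))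
    MvPowerSeries.C_injective p

/-- A quotient of a local ring of prime characteristic `p` by an element of the maximal ideal has
characteristic `p`. -/
theorem charP_quotient_span_singleton (p : ℕ) [Fact p.Prime] {A : Type*} [CommRing A]
    [IsLocalRing A] [CharP A p] {f : A} (hf : f ∈ IsLocalRing.maximalIdeal A) :
    CharP (A ⧸ Ideal.span {f}) p := by
  have hne : Ideal.span {f} ≠ ⊤ := by
    rw [Ne, Ideal.span_singleton_eq_top]
    exact (IsLocalRing.mem_maximalIdeal f).1 hf
  have : Nontrivial (A ⧸ Ideal.span {f}) := Ideal.Quotient.nontrivial_iff.2 hne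
  have h0 : ((p : ℕ) : A ⧸ Ideal.span {f}) = 0 := by
    rw [← map_natCast (Ideal.Quotient.mk (Ideal.span {f})) p, CharP.cast_eq_zero, map_zero]
  have hdvd : ringChar (A ⧸ Ideal.span {f}) ∣ p := (ringChar.spec _ p).1 h0
  have hp : ringChar (A ⧸ Ideal.span {f}) = p :=
    ((Nat.dvd_prime Fact.out).1 hdvd).resolve_left (CharP.ringChar_ne_one)
  exact ringChar.of_eq hp

/-! ### Free direct summands and the F-signature -/

/-- `M ≅ A^r ⊕ N` for some `A`-module `N` (necessarily isomorphic to a submodule of `M`). -/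
def HasFreeSummand (A M : Type*) [CommRing A] [AddCommGroup M] [Module A M] (r : ℕ) : Prop :=
  ∃ N : Submodule A M, Nonempty (M ≃ₗ[A] (Fin r → A) × N)

/-- `M ≅ A^a ⊕ N`, where the `A`-module `N` has no nonzero free direct summand. -/
def IsFreeRank (A M : Type*) [CommRing A] [AddCommGroup M] [Module A M] (a : ℕ) : Prop :=
  ∃ N : Submodule A M, Nonempty (M ≃ₗ[A] (Fin a → A) × N) ∧ ¬ HasFreeSummand A N 1

/-- `s` is the F-signature of the `d`-dimensional ring `A` of characteristic `p`: for every `e > 0`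
there is a decomposition `F^e_* A ≅ A^{a_e} ⊕ M_e` with `M_e` without free direct summands, and
`a_e / p^{ed} → s` for every choice of such decompositions. -/
def IsFSignature (p : ℕ) (A : Type*) [CommRing A] [Fact p.Prime] [CharP A p] (s : ℝ) : Prop :=
  ∃ d : ℕ, ringKrullDim A = d ∧
    (∀ e : ℕ, 0 < e → ∃ a : ℕ, IsFreeRank A (FrobPush p e A) a) ∧
    ∀ a : ℕ → ℕ, (∀ e : ℕ, 0 < e → IsFreeRank A (FrobPush p e A) (a e)) →
      Tendsto (fun e : ℕ => (a e : ℝ) / (p : ℝ) ^ (e * d)) atTop (𝓝 s)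

/-! ### Matrix factorizations -/

section MatrixFactorizations

variable {S F G : Type*} [CommRing S] [AddCommGroup F] [Module S F] [AddCommGroup G] [Module S G]

/-- `(ρ, σ)`, with `ρ : G → F` and `σ : F → G`, is a matrix factorization of `α`. -/
structure IsMatrixFactorization (α : S) (ρ : G →ₗ[S] F) (σ : F →ₗ[S] G) : Prop where
  free_left : Module.Free S F
  finite_left : Module.Finite S F
  free_right : Module.Free S G
  finite_right : Module.Finite S G
  finrank_eq : Module.finrank S F = Module.finrank S G
  comp_left : ρ ∘ₗ σ = α • LinearMap.id
  comp_right : σ ∘ₗ ρ = α • LinearMap.id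

/-- A pair of square matrices of the same size. -/
abbrev MatrixPair (S ι : Type*) := Matrix ι ι S × Matrix ι ι S

/-- The direct sum (block diagonal sum) of two pairs of square matrices. -/
def MatrixPair.directSum {S ι κ : Type*} [CommRing S] (P : MatrixPair S ι) (Q : MatrixPair S κ) :
    MatrixPair S (ι ⊕ κ) :=
  (Matrix.fromBlocks P.1 0 0 Q.1, Matrix.fromBlocks P.2 0 0 Q.2)

/-- `(α, id)^{⊕ v}` as a pair of `v × v` matrices. -/
def MatrixPair.trivialLeft {S : Type*} [CommRing S] (α : S) (v : ℕ) : MatrixPair S (Fin v) :=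
  (Matrix.scalar (Fin v) α, 1)

/-- `(id, α)^{⊕ u}` as a pair of `u × u` matrices. -/
def MatrixPair.trivialRight {S : Type*} [CommRing S] (α : S) (u : ℕ) : MatrixPair S (Fin u) :=
  (1, Matrix.scalar (Fin u) α)

/-- A reduced matrix factorization of `α`, in matrix form: all entries lie in the maximal ideal. -/
structure MatrixPair.IsReduced {S : Type*} [CommRing S] [IsLocalRing S] (α : S) {r : ℕ}
    (γ : MatrixPair S (Fin r)) : Prop where
  mul_left : γ.1 * γ.2 = Matrix.scalar (Fin r) α
  mul_right : γ.2 * γ.1 = Matrix.scalar (Fin r) α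
  fst_mem : ∀ i j, γ.1 i j ∈ IsLocalRing.maximalIdeal S
  snd_mem : ∀ i j, γ.2 i j ∈ IsLocalRing.maximalIdeal S

/-- `(ρ, σ) ≅ (α, id)^{⊕ v} ⊕ (id, α)^{⊕ u} ⊕ (γ₁, γ₂)` with `γ = (γ₁, γ₂)` reduced: in suitable
bases of `F` and `G`, the maps `ρ` and `σ` are given by the block diagonal matrices on the right. -/
def IsMFDecomposition [IsLocalRing S] (α : S) (ρ : G →ₗ[S] F) (σ : F →ₗ[S] G) (v u : ℕ) {r : ℕ}
    (γ : MatrixPair S (Fin r)) : Prop :=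
  γ.IsReduced α ∧
  ∃ (bF : Module.Basis (Fin v ⊕ Fin u ⊕ Fin r) S F) (bG : Module.Basis (Fin v ⊕ Fin u ⊕ Fin r) S G),
    (LinearMap.toMatrix bG bF ρ, LinearMap.toMatrix bF bG σ) =
      (MatrixPair.trivialLeft α v).directSum ((MatrixPair.trivialRight α u).directSum γ)

end MatrixFactorizations

/-! ### The modules `M_{e,t}` and the function `ξ_f` -/

section Xi

/-- The ideal `(f^t) + 𝔪^{[p^e]}`, where `𝔪^{[p^e]}` is generated by the `p^e`-th powers of the
elements of the maximal ideal `𝔪`. -/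
def idealPowAdd (p : ℕ) {S : Type*} [CommRing S] [IsLocalRing S] (f : S) (e t : ℕ) : Ideal S :=
  Ideal.span {f ^ t} ⊔
    Ideal.span ((fun a : S => a ^ p ^ e) '' (IsLocalRing.maximalIdeal S : Set S))

/-- `M_{e,t} = ((f^t) + 𝔪^{[p^e]}) / ((f^{t+1}) + 𝔪^{[p^e]})`. -/
abbrev ModuleM (p : ℕ) {S : Type*} [CommRing S] [IsLocalRing S] (f : S) (e t : ℕ) : Type _ :=
  ↥(idealPowAdd p f e t) ⧸
    Submodule.comap (idealPowAdd p f e t).subtype (idealPowAdd p f e (t + 1))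

variable {k : Type*} [Field k] {n : ℕ}

/-- `C_{e,t} = ℓ_R(M_{e,t}) / p^{en}` for `R = k⟦X_1, …, X_{n+1}⟧`. -/
noncomputable def coeffC (p : ℕ) (f : MvPowerSeries (Fin (n + 1)) k) (e t : ℕ) : ℝ :=
  ((Module.length (MvPowerSeries (Fin (n + 1)) k) (ModuleM p f e t)).toNat : ℝ) /
    (p : ℝ) ^ (e * n)

open Classical in
/-- `ξ_{f,e}(x) = C_{e,⌊x p^e⌋}` for `0 ≤ x < 1` and `ξ_{f,e}(1) = C_{e,p^e-1}`. -/
noncomputable def xiSeq (p : ℕ) (f : MvPowerSeries (Fin (n + 1)) k) (e : ℕ)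
    (x : Set.Icc (0 : ℝ) 1) : ℝ :=
  if (x : ℝ) < 1 then coeffC p f e ⌊(x : ℝ) * (p : ℝ) ^ e⌋₊ else coeffC p f e (p ^ e - 1)

/-- `ξ_f(x) = limsup_{e → ∞} ξ_{f,e}(x)`. -/
noncomputable def xi (p : ℕ) (f : MvPowerSeries (Fin (n + 1)) k) (x : Set.Icc (0 : ℝ) 1) : ℝ :=
  limsup (fun e : ℕ => xiSeq p f e x) atTop

end Xi

/-! Write q = p^e. Since k is perfect, F^e_*R is free over R on the q^(n+1) monomials with exponents
below q. On it F^e_*(f) and F^e_*(f^(q-1)) compose to f^q = f • id, a matrix factorization. Any unit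
entry of either map splits off a trivial summand, so induction on the rank gives the decomposition.

The number v is a difference of lengths. Modulo 𝔪 the map F^e_*(f^(q-1)) is the identity on the
v-block and zero elsewhere, so R/(f^(q-1), 𝔪^[q]) has length u + r, while R/𝔪^[q] has length v + u +
r. As f^q ∈ 𝔪^[q], the difference is ℓ(M_{e,q-1}) (`IsMFDecomposition.eq_length_moduleM`).

The cokernel of F^e_*(f) is F^e_*(R/f) = (R/f)^v ⊕ coker γ₁. A functional on coker γ₁ lifts to a row
c with c γ₁ = f d; then f c = c γ₁ γ₂ = f d γ₂, so c = d γ₂ has entries in 𝔪 and no free summand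
remains (`IsMFDecomposition.isFreeRank`). Nakayama makes the free rank unique.

For the limit, multiplication by f shows that ℓ(M_{e,t}) decreases in t, and freeness of Frobenius
multiplies colengths by p^(n+1). Comparing the last p steps at level e + 1 with the last step at
level e shows that C_{e,q-1} decreases in e (`mul_length_moduleM_succ_le`). Being nonnegative, it
converges, and its limit is its limsup ξ_f(1). -/

namespace MvPowerSeries

/-! ### The monomial basis of the Frobenius push-forward -/

variable {σ k : Type*} [CommRing k] (p e : ℕ) [Fact p.Prime] [CharP k p]

theorem coeff_smul_pow_primePow (s : MvPowerSeries σ k) (m : σ →₀ ℕ) :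
    coeff (p ^ e • m) (s ^ p ^ e) = (coeff m s) ^ p ^ e := by
  have hp : p ≠ 0 := (Fact.out : p.Prime).ne_zero
  rw [← map_iterateFrobenius_expand p hp s e, coeff_map, coeff_expand_smul, iterateFrobenius_def]

theorem coeff_pow_primePow_of_not_dvd (s : MvPowerSeries σ k) {d : σ →₀ ℕ} {i : σ}
    (h : ¬ p ^ e ∣ d i) : coeff d (s ^ p ^ e) = 0 := by
  have hp : p ≠ 0 := (Fact.out : p.Prime).ne_zero
  rw [← map_iterateFrobenius_expand p hp s e, coeff_map, coeff_expand_of_not_dvd _ _ _ h, map_zero]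

variable [Fintype σ]

/-- The exponent vector attached to a tuple of residues. -/
noncomputable def expOfFin (q : ℕ) (a : σ → Fin q) : σ →₀ ℕ :=
  Finsupp.equivFunOnFinite.symm fun i => (a i : ℕ)

@[simp]
theorem expOfFin_apply (q : ℕ) (a : σ → Fin q) (i : σ) : expOfFin q a i = a i := rfl

/-- The exponents of `s ^ p ^ e` are multiples of `p ^ e`, so distinct residue vectors contribute to
disjoint sets of exponents. -/
theorem coeff_pow_primePow_mul_monomial (s : MvPowerSeries σ k) (m : σ →₀ ℕ)
    (a b : σ → Fin (p ^ e)) [Decidable (b = a)] :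
    coeff (p ^ e • m + expOfFin _ a) (s ^ p ^ e * monomial (expOfFin _ b) 1) =
      if b = a then (coeff m s) ^ p ^ e else 0 := by
  classical
  rw [coeff_mul_monomial, mul_one]
  split_ifs with h1 h2 h2
  · subst h2
    rw [add_tsub_cancel_right, coeff_smul_pow_primePow]
  · obtain ⟨i, hi⟩ := Function.ne_iff.1 h2
    refine coeff_pow_primePow_of_not_dvd p e s (i := i) fun hd => hi ?_
    have h1i := h1 i
    simp only [Finsupp.coe_tsub, Finsupp.coe_add, Finsupp.coe_smul, Pi.sub_apply, Pi.add_apply,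
      Pi.smul_apply, smul_eq_mul, expOfFin_apply] at hd h1i
    have h3 := (Nat.modEq_iff_dvd' h1i).2 hd
    rw [Nat.ModEq, Nat.mul_add_mod, Nat.mod_eq_of_lt (b i).2, Nat.mod_eq_of_lt (a i).2] at h3
    exact Fin.ext h3
  · subst h2
    exact absurd le_add_self h1
  · rfl

theorem exists_eq_smul_add_expOfFin (d : σ →₀ ℕ) :
    ∃ (m : σ →₀ ℕ) (a : σ → Fin (p ^ e)), d = p ^ e • m + expOfFin _ a := by
  have hq : 0 < p ^ e := pow_pos (Fact.out : p.Prime).pos e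
  refine ⟨Finsupp.equivFunOnFinite.symm fun i => d i / p ^ e,
    fun i => ⟨d i % p ^ e, Nat.mod_lt _ hq⟩, ?_⟩
  ext i
  simp [Nat.div_add_mod]

/-- `F^e_*` of a power series ring over a perfect ring has the monomials with exponents less than
`p ^ e` as a basis. -/
noncomputable def frobPushEquiv [PerfectRing k p] :
    ((σ → Fin (p ^ e)) → MvPowerSeries σ k) ≃ₗ[MvPowerSeries σ k]
      FrobPush p e (MvPowerSeries σ k) := by
  classical
  let Φ := Fintype.linearCombination (MvPowerSeries σ k) fun a : σ → Fin (p ^ e) =>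
    FrobPush.of p e (MvPowerSeries σ k) (monomial (expOfFin _ a) 1)
  have hΦ (c : (σ → Fin (p ^ e)) → MvPowerSeries σ k) (m : σ →₀ ℕ) (a : σ → Fin (p ^ e)) :
      coeff (p ^ e • m + expOfFin _ a) ((FrobPush.of p e _).symm (Φ c)) =
        (coeff m (c a)) ^ p ^ e := by
    simp only [Φ, Fintype.linearCombination_apply, FrobPush.smul_of, map_sum,
      AddEquiv.symm_apply_apply, coeff_pow_primePow_mul_monomial]
    simp
  have hinj : Function.Injective (fun x : k => x ^ p ^ e) := fun x y h =>
    (iterateFrobeniusEquiv k p e).injective h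
  refine LinearEquiv.ofBijective Φ ⟨fun c c' h => ?_, fun y => ?_⟩
  · funext a
    ext m
    apply hinj
    simp only
    rw [← hΦ, ← hΦ, h]
  -- Spanning requires `p ^ e`-th roots of all coefficients; perfectness supplies them.
  · choose r hr using fun x : k => (iterateFrobeniusEquiv k p e).surjective x
    simp only [iterateFrobeniusEquiv_def] at hr
    refine ⟨fun a m => r (coeff (p ^ e • m + expOfFin _ a) ((FrobPush.of p e _).symm y)), ?_⟩
    apply (FrobPush.of p e _).symm.injective
    ext d
    obtain ⟨m, a, rfl⟩ := exists_eq_smul_add_expOfFin p e d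
    exact (hΦ _ m a).trans (hr _)

/-- The monomial basis of `F^e_*` of a power series ring over a perfect ring. -/
noncomputable def frobPushBasis [PerfectRing k p] :
    Module.Basis (σ → Fin (p ^ e)) (MvPowerSeries σ k) (FrobPush p e (MvPowerSeries σ k)) :=
  Module.Basis.ofEquivFun (frobPushEquiv p e).symm

end MvPowerSeries

/-! ### Length under change of rings and in free modules -/

section Length

/-- The maximal ideal of `B` kills a simple module, so each `b` acts as some element of `A`. -/
theorem IsSimpleModule.of_residually_surjective {A B M : Type*} [CommRing A] [CommRing B]
    [IsLocalRing B] [Algebra A B] [AddCommGroup M] [Module A M] [Module B M] [IsScalarTower A B M]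
    (h : ∀ b : B, ∃ a : A, b - algebraMap A B a ∈ IsLocalRing.maximalIdeal B)
    [IsSimpleModule B M] : IsSimpleModule A M := by
  have := IsSimpleModule.nontrivial B M
  refine isSimpleModule_iff_toSpanSingleton_surjective.2 ⟨this, fun x hx y => ?_⟩
  obtain ⟨b, hb⟩ := (isSimpleModule_iff_toSpanSingleton_surjective (R := B).1
    inferInstance).2 x hx y
  obtain ⟨a, ha⟩ := h b
  refine ⟨a, ?_⟩
  rw [← IsLocalRing.eq_maximalIdeal (IsSimpleModule.annihilator_isMaximal (R := B) (M := M))] at ha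
  have h0 := Module.mem_annihilator.1 ha x
  rw [sub_smul, algebraMap_smul, sub_eq_zero] at h0
  simpa [← h0] using hb

/-- Induction along a composition series. The `A`-structure is quantified after the colon so that it
varies with `M`. -/
theorem Module.length_eq_of_isFiniteLength_of_residually_surjective {A B M : Type*} [CommRing A]
    [CommRing B] [IsLocalRing B] [Algebra A B] [AddCommGroup M] [Module B M]
    (h : ∀ b : B, ∃ a : A, b - algebraMap A B a ∈ IsLocalRing.maximalIdeal B)
    (hM : IsFiniteLength B M) :
    ∀ [Module A M] [IsScalarTower A B M], Module.length A M = Module.length B M := by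
  induction hM with
  | of_subsingleton => intros; rw [Module.length_eq_zero, Module.length_eq_zero]
  | @of_simple_quotient M _ _ N _ _ ih =>
    intro _ _
    have := IsSimpleModule.of_residually_surjective (M := M ⧸ N) h
    rw [Module.length_eq_add_of_exact N.subtype N.mkQ N.subtype_injective N.mkQ_surjective
        (LinearMap.exact_subtype_mkQ N),
      Module.length_eq_add_of_exact (N.subtype.restrictScalars A) (N.mkQ.restrictScalars A)
        N.subtype_injective N.mkQ_surjective (LinearMap.exact_subtype_mkQ N), ih,
      Module.length_eq_one A (M ⧸ N), Module.length_eq_one B (M ⧸ N)]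

/-- Length does not change under restriction of scalars along a ring homomorphism to a local ring
that is surjective on residue fields. -/
theorem Module.length_eq_of_residually_surjective {A B N P : Type*} [CommRing A] [CommRing B]
    [IsLocalRing B] [AddCommGroup N] [Module B N] [AddCommGroup P] [Module A P] (φ : A →+* B)
    (h : ∀ b : B, ∃ a : A, b - φ a ∈ IsLocalRing.maximalIdeal B) (ε : N ≃+ P)
    (hε : ∀ (a : A) (x : N), ε (φ a • x) = a • ε x) :
    Module.length A P = Module.length B N := by
  let := φ.toAlgebra
  let : Module A N := Module.compHom N φ
  have : IsScalarTower A B N := ⟨fun a b x => by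
    change (φ a * b) • x = φ a • b • x
    rw [mul_smul]⟩
  let L : N ≃ₗ[A] P := { ε with map_smul' := hε }
  rw [← L.length_eq]
  by_cases hN : IsFiniteLength B N
  · exact Module.length_eq_of_isFiniteLength_of_residually_surjective h hN
  -- Every `B`-submodule is an `A`-submodule, so infinite length over `B` forces infinite length
  -- over `A`.
  · rw [← Module.length_ne_top_iff, not_not] at hN
    rw [hN, ← top_le_iff, ← hN, ← Module.length_top (R := B), ← Module.length_top (R := A)]
    exact Submodule.length_le_length_restrictScalars A (⊤ : Submodule B N)

/-- Reducing the coordinates selected by `j` modulo `I` maps `F` onto (S/I)^κ with kernel `N`. It is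
applied with all coordinates, and with those outside the first block of a decomposition. -/
theorem Module.Basis.length_quotient_of_mem_iff {S F ι κ : Type*} [CommRing S] [AddCommGroup F]
    [Module S F] [Fintype ι] [Fintype κ] (b : Module.Basis ι S F) (j : κ ↪ ι) (I : Ideal S)
    (N : Submodule S F) (hN : ∀ x, x ∈ N ↔ ∀ i, b.repr x (j i) ∈ I) :
    Module.length S (F ⧸ N) = Fintype.card κ * Module.length S (S ⧸ I) := by
  classical
  let T : F →ₗ[S] (κ → S ⧸ I) :=
    LinearMap.pi fun i => I.mkQ ∘ₗ LinearMap.proj (j i) ∘ₗ b.equivFun.toLinearMap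
  have hT (x : F) (i : κ) : T x i = I.mkQ (b.repr x (j i)) := rfl
  have hker : LinearMap.ker T = N := by
    ext x
    rw [LinearMap.mem_ker, hN, funext_iff]
    simp only [hT, Pi.zero_apply, ← LinearMap.mem_ker, Submodule.ker_mkQ]
  have hsurj : Function.Surjective T := by
    intro y
    choose z hz using fun i => I.mkQ_surjective (y i)
    refine ⟨b.equivFun.symm (Function.extend j z 0), funext fun i => ?_⟩
    rw [hT, ← hz, ← Module.Basis.equivFun_apply, LinearEquiv.apply_symm_apply,
      j.injective.extend_apply]
  rw [((Submodule.quotEquivOfEq _ _ hker.symm).trans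
    (T.quotKerEquivOfSurjective hsurj)).length_eq]
  simp

theorem Module.Basis.mem_ideal_smul_top_iff {S F ι : Type*} [CommRing S] [AddCommGroup F]
    [Module S F] [Fintype ι] (b : Module.Basis ι S F) (I : Ideal S) (x : F) :
    x ∈ I • (⊤ : Submodule S F) ↔ ∀ i, b.repr x i ∈ I := by
  constructor
  · intro hx i
    induction hx using Submodule.smul_induction_on' with
    | smul r hr n _ => simpa using I.mul_mem_right _ hr
    | add x _ y _ hx hy => simpa using I.add_mem hx hy
  · intro h
    rw [← b.sum_repr x]
    exact Submodule.sum_mem _ fun i _ => Submodule.smul_mem_smul (h i) trivial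

end Length

/-! ### Colengths of ideals and Frobenius -/

namespace FrobPush

section

variable {A : Type*} [CommRing A] (p e : ℕ) [Fact p.Prime] [CharP A p]

/-- An ideal `J` of `A` as a submodule of `F^e_* A`. -/
noncomputable def submodule (J : Ideal A) : Submodule A (FrobPush p e A) where
  carrier := {x | (of p e A).symm x ∈ J}
  add_mem' := fun hx hy => J.add_mem hx hy
  zero_mem' := by simp
  smul_mem' := fun a x hx => by
    obtain ⟨s, rfl⟩ := (of p e A).surjective x
    rw [Set.mem_ofPred_eq, AddEquiv.symm_apply_apply] at hx
    rw [Set.mem_ofPred_eq, smul_of, AddEquiv.symm_apply_apply]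
    exact J.mul_mem_left _ hx

@[simp]
theorem of_mem_submodule {J : Ideal A} {s : A} : of p e A s ∈ submodule p e J ↔ s ∈ J := Iff.rfl

@[simp]
theorem mul_of (g s : A) : mul p e g (of p e A s) = of p e A (g * s) := rfl

/-- The additive group is unchanged, and Frobenius is surjective on the residue field by `h`. -/
theorem length_quotient_submodule [IsLocalRing A]
    (h : ∀ b : A, ∃ a : A, b - a ^ p ^ e ∈ IsLocalRing.maximalIdeal A) (J : Ideal A) :
    Module.length A (FrobPush p e A ⧸ submodule p e J) = Module.length A (A ⧸ J) := by
  let ε : (A ⧸ J) ≃+ (FrobPush p e A ⧸ submodule p e J) :=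
    QuotientAddGroup.congr J.toAddSubgroup (submodule p e J).toAddSubgroup (of p e A) (by
      ext x
      constructor
      · rintro ⟨s, hs, rfl⟩
        exact hs
      · intro hx
        exact ⟨(of p e A).symm x, hx, by simp⟩)
  refine Module.length_eq_of_residually_surjective (iterateFrobenius A p e) h ε fun a x => ?_
  obtain ⟨s, rfl⟩ := Submodule.Quotient.mk_surjective _ x
  rfl

theorem submodule_map_iterateFrobenius (I : Ideal A) :
    submodule p e (I.map (iterateFrobenius A p e)) = I • ⊤ := by
  apply le_antisymm
  · intro x hx
    obtain ⟨s, rfl⟩ := (of p e A).surjective x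
    rw [of_mem_submodule] at hx
    induction hx using Submodule.span_induction with
    | mem s hs =>
      obtain ⟨a, ha, rfl⟩ := hs
      have := Submodule.smul_mem_smul ha (Submodule.mem_top (x := of p e A 1))
      rwa [smul_of, mul_one] at this
    | zero => rw [map_zero]; exact Submodule.zero_mem _
    | add s t _ _ hs ht => rw [map_add]; exact Submodule.add_mem _ hs ht
    | smul g s _ hs =>
      rw [smul_eq_mul, ← mul_of]
      -- The linear map `mul p e g` preserves `I • ⊤`, which gives closure under all of `A` and not
      -- only under `p ^ e`-th powers.
      have h1 := Submodule.mem_map_of_mem (f := mul p e g) hs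
      rw [Submodule.map_smul''] at h1
      exact Submodule.smul_mono le_rfl le_top h1
  · refine Submodule.smul_le.2 fun a ha x _ => ?_
    obtain ⟨s, rfl⟩ := (of p e A).surjective x
    rw [smul_of, of_mem_submodule]
    exact Ideal.mul_mem_right _ _ (Ideal.mem_map_of_mem (iterateFrobenius A p e) ha)

theorem length_quotient_map_iterateFrobenius [IsLocalRing A] {ι : Type*} [Fintype ι]
    (b : Module.Basis ι A (FrobPush p e A))
    (h : ∀ b : A, ∃ a : A, b - a ^ p ^ e ∈ IsLocalRing.maximalIdeal A) (I : Ideal A) :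
    Module.length A (A ⧸ I.map (iterateFrobenius A p e)) =
      Fintype.card ι * Module.length A (A ⧸ I) := by
  rw [← length_quotient_submodule p e h, submodule_map_iterateFrobenius]
  exact b.length_quotient_of_mem_iff (Function.Embedding.refl ι) I _ (b.mem_ideal_smul_top_iff I)

end

end FrobPush

/-! ### Lengths of the modules M_{e,t} -/

section ModuleM

variable {S : Type*} [CommRing S] [IsLocalRing S] (p : ℕ) {f : S}

theorem idealPowAdd_succ_le (e t : ℕ) : idealPowAdd p f e (t + 1) ≤ idealPowAdd p f e t :=
  sup_le_sup_right (Ideal.span_singleton_le_span_singleton.2 (pow_dvd_pow f t.le_succ)) _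

theorem length_quotient_idealPowAdd_succ (e t : ℕ) :
    Module.length S (S ⧸ idealPowAdd p f e (t + 1)) =
      Module.length S (ModuleM p f e t) + Module.length S (S ⧸ idealPowAdd p f e t) := by
  have hle := idealPowAdd_succ_le p (f := f) e t
  refine Module.length_eq_add_of_exact
    (Submodule.mapQ _ _ (idealPowAdd p f e t).subtype le_rfl) (Submodule.factor hle) ?_
    (Submodule.factor_surjective hle) fun x => ?_
  · rw [← LinearMap.ker_eq_bot, Submodule.ker_mapQ, Submodule.mkQ_map_self]
  · obtain ⟨x, rfl⟩ := Submodule.Quotient.mk_surjective _ x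
    simp only [Submodule.factor, Submodule.mapQ_apply, LinearMap.id_apply, Submodule.Quotient.mk_eq_zero]
    constructor
    · intro hx
      exact ⟨Submodule.Quotient.mk ⟨x, hx⟩, rfl⟩
    · rintro ⟨y, hy⟩
      obtain ⟨y, rfl⟩ := Submodule.Quotient.mk_surjective _ y
      rw [Submodule.mapQ_apply, Submodule.Quotient.eq] at hy
      have := Submodule.sub_mem _ y.2 (hle hy)
      simpa using this

/-- Multiplication by `f` induces a surjection M_{e,t} → M_{e,t+1}. -/
theorem length_moduleM_succ_le (e t : ℕ) :
    Module.length S (ModuleM p f e (t + 1)) ≤ Module.length S (ModuleM p f e t) := by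
  have hmem (s : ℕ) (x : S) (hx : x ∈ idealPowAdd p f e s) : f * x ∈ idealPowAdd p f e (s + 1) := by
    obtain ⟨y, hy, z, hz, rfl⟩ := Submodule.mem_sup.1 hx
    obtain ⟨c, rfl⟩ := Ideal.mem_span_singleton'.1 hy
    rw [mul_add]
    refine Submodule.add_mem_sup ?_ (Ideal.mul_mem_left _ _ hz)
    exact Ideal.mem_span_singleton'.2 ⟨c, by ring⟩
  let g : idealPowAdd p f e t →ₗ[S] idealPowAdd p f e (t + 1) :=
    (LinearMap.mulLeft S f).restrict (hmem t)
  refine Module.length_le_of_surjective (Submodule.mapQ _ _ g fun x hx => hmem (t + 1) x hx) ?_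
  intro y
  obtain ⟨⟨y, hy⟩, rfl⟩ := Submodule.Quotient.mk_surjective _ y
  obtain ⟨a, ha, z, hz, rfl⟩ := Submodule.mem_sup.1 hy
  obtain ⟨c, rfl⟩ := Ideal.mem_span_singleton'.1 ha
  refine ⟨Submodule.Quotient.mk ⟨c * f ^ t, ?_⟩, ?_⟩
  · exact Submodule.mem_sup_left (Ideal.mem_span_singleton'.2 ⟨c, rfl⟩)
  · refine (Submodule.Quotient.eq _).2 ?_
    change f * (c * f ^ t) - (c * f ^ (t + 1) + z) ∈ idealPowAdd p f e (t + 1 + 1)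
    have : f * (c * f ^ t) - (c * f ^ (t + 1) + z) = - z := by ring
    rw [this]
    exact Submodule.mem_sup_right (neg_mem hz)

theorem length_moduleM_antitone (e : ℕ) :
    Antitone fun t => Module.length S (ModuleM p f e t) :=
  antitone_nat_of_succ_le (length_moduleM_succ_le p e)

/-- Each of the `j` steps from `t` to `t + j` has index at most `s`, hence contributes at least the
length of M_{e,s}. The sum form avoids subtraction in `ℕ∞`. -/
theorem length_quotient_idealPowAdd_add_mul_le (e t j s : ℕ) (h : t + j ≤ s + 1) :
    Module.length S (S ⧸ idealPowAdd p f e t) + j * Module.length S (ModuleM p f e s) ≤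
      Module.length S (S ⧸ idealPowAdd p f e (t + j)) := by
  induction j with
  | zero => simp
  | succ j ih =>
    rw [← add_assoc t, length_quotient_idealPowAdd_succ, Nat.cast_succ, add_mul, one_mul,
      ← add_assoc, add_comm]
    exact add_le_add (length_moduleM_antitone p e (by lia)) (ih (by lia))

theorem length_quotient_idealPowAdd_pow_sub_one [Fact p.Prime] (e : ℕ) :
    Module.length S (S ⧸ idealPowAdd p f e (p ^ e)) =
      Module.length S (ModuleM p f e (p ^ e - 1)) +
        Module.length S (S ⧸ idealPowAdd p f e (p ^ e - 1)) := by
  have hq : p ^ e - 1 + 1 = p ^ e := Nat.sub_add_cancel (pow_pos (Fact.out : p.Prime).pos e)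
  rw [← length_quotient_idealPowAdd_succ, hq]

variable [Fact p.Prime] [CharP S p]

theorem idealPowAdd_eq (e t : ℕ) : idealPowAdd p f e t =
    Ideal.span {f ^ t} ⊔ (IsLocalRing.maximalIdeal S).map (iterateFrobenius S p e) := rfl

theorem map_iterateFrobenius_idealPowAdd (e e' t : ℕ) :
    (idealPowAdd p f e t).map (iterateFrobenius S p e') =
      idealPowAdd p f (e + e') (p ^ e' * t) := by
  rw [idealPowAdd_eq, idealPowAdd_eq, Ideal.map_sup, Ideal.map_span, Ideal.map_map,
    Set.image_singleton, iterateFrobenius_def, ← pow_mul, mul_comm t]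
  congr 2
  ext x
  simp [iterateFrobenius_def, ← pow_mul, ← pow_add]

theorem idealPowAdd_pow (e : ℕ) (hf : f ∈ IsLocalRing.maximalIdeal S) :
    idealPowAdd p f e (p ^ e) =
      (IsLocalRing.maximalIdeal S).map (iterateFrobenius S p e) := by
  rw [idealPowAdd_eq, sup_eq_right, Ideal.span_singleton_le_iff_mem]
  exact Ideal.mem_map_of_mem (iterateFrobenius S p e) hf

theorem length_quotient_maximalIdeal :
    Module.length S (S ⧸ IsLocalRing.maximalIdeal S) = 1 := by
  have : IsSimpleModule S (S ⧸ IsLocalRing.maximalIdeal S) :=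
    isSimpleModule_iff_quot_maximal.2 ⟨_, inferInstance, ⟨LinearEquiv.refl _ _⟩⟩
  exact Module.length_eq_one S _

theorem length_quotient_idealPowAdd_pow (e : ℕ) {ι : Type*} [Fintype ι]
    (b : Module.Basis ι S (FrobPush p e S))
    (h : ∀ b : S, ∃ a : S, b - a ^ p ^ e ∈ IsLocalRing.maximalIdeal S)
    (hf : f ∈ IsLocalRing.maximalIdeal S) :
    Module.length S (S ⧸ idealPowAdd p f e (p ^ e)) = Fintype.card ι := by
  rw [idealPowAdd_pow p e hf, FrobPush.length_quotient_map_iterateFrobenius p e b h,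
    length_quotient_maximalIdeal, mul_one]

/-- The lengths of the last modules `M_{e, p ^ e - 1}` grow at most by the factor `rank F_* S / p`
in each step. -/
theorem mul_length_moduleM_succ_le (e : ℕ) {ι κ : Type*} [Fintype ι] [Fintype κ]
    (b₁ : Module.Basis ι S (FrobPush p 1 S)) (b : Module.Basis κ S (FrobPush p e S))
    (h : ∀ (e : ℕ) (b : S), ∃ a : S, b - a ^ p ^ e ∈ IsLocalRing.maximalIdeal S)
    (hf : f ∈ IsLocalRing.maximalIdeal S) :
    p * Module.length S (ModuleM p f (e + 1) (p ^ (e + 1) - 1)) ≤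
      Fintype.card ι * Module.length S (ModuleM p f e (p ^ e - 1)) := by
  have hq : 1 ≤ p ^ e := pow_pos (Fact.out : p.Prime).pos e
  have h0 (t : ℕ) : Module.length S (S ⧸ idealPowAdd p f (e + 1) (p * t)) =
      Fintype.card ι * Module.length S (S ⧸ idealPowAdd p f e t) := by
    have := map_iterateFrobenius_idealPowAdd p (f := f) e 1 t
    rw [pow_one] at this
    rw [← this, FrobPush.length_quotient_map_iterateFrobenius p 1 b₁ (h 1)]
  -- The last `p` steps below `p ^ (e + 1)` start at `p * (p ^ e - 1)`, where both ends are
  -- multiples of `p` and `h0` applies.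
  have h1 := length_quotient_idealPowAdd_add_mul_le p (f := f) (e + 1) (p * (p ^ e - 1)) p
    (p ^ (e + 1) - 1) (by rw [Nat.mul_sub, pow_succ', mul_one, Nat.sub_add_cancel
                            (Nat.le_mul_of_pos_right p hq)]; lia)
  have h2 : p * (p ^ e - 1) + p = p * p ^ e := by
    rw [← Nat.mul_succ, Nat.succ_eq_add_one, Nat.sub_add_cancel hq]
  rw [h2, h0, h0, length_quotient_idealPowAdd_pow_sub_one, mul_add, add_comm] at h1
  -- Cancellation in `ℕ∞` needs a finite term; it is bounded through the colength of 𝔪^[p^e], which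
  -- is the rank of F^e_*S.
  refine (ENat.add_le_add_iff_right (ne_of_lt ?_)).1 h1
  refine lt_of_le_of_lt (b := ((Fintype.card ι * Fintype.card κ : ℕ) : ℕ∞)) ?_
    (ENat.natCast_lt_top _)
  rw [Nat.cast_mul, ← length_quotient_idealPowAdd_pow p e b (h e) hf,
    length_quotient_idealPowAdd_pow_sub_one]
  exact mul_le_mul_right le_add_self _

end ModuleM

/-! ### Splitting off trivial matrix factorizations -/

section Splitting

universe u

variable {S : Type*} [CommRing S]

/-- The splitting `E × ker φ ≃ F` given by a section `s` of `φ : F → E`. -/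
def LinearMap.prodKerEquiv {F E : Type*} [AddCommGroup F] [Module S F] [AddCommGroup E]
    [Module S E] (φ : F →ₗ[S] E) (s : E →ₗ[S] F) (hs : ∀ y, φ (s y) = y) :
    (E × LinearMap.ker φ) ≃ₗ[S] F where
  toFun y := s y.1 + y.2
  map_add' y z := by simp only [Prod.fst_add, Prod.snd_add, Submodule.coe_add, map_add]; abel
  map_smul' c y := by simp
  invFun y := (φ y, ⟨y - s (φ y), by simp [hs]⟩)
  left_inv y := by
    have h : φ (y.2 : F) = 0 := y.2.2
    ext <;> simp [hs, h]
  right_inv y := by simp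

/-- A basis of `ker φ` together with an element `x` with `φ x = 1` gives a basis. -/
noncomputable def LinearMap.basisOfKer {F I : Type*} [AddCommGroup F] [Module S F]
    (φ : F →ₗ[S] S) (x : F) (hx : φ x = 1) (b : Module.Basis I S (LinearMap.ker φ)) :
    Module.Basis (Unit ⊕ I) S F :=
  ((Module.Basis.singleton Unit S).prod b).map
    (φ.prodKerEquiv (LinearMap.toSpanSingleton S F x) (by simp [hx]))

@[simp]
theorem LinearMap.basisOfKer_inl {F I : Type*} [AddCommGroup F] [Module S F]
    (φ : F →ₗ[S] S) (x : F) (hx : φ x = 1) (b : Module.Basis I S (LinearMap.ker φ)) (i : Unit) :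
    φ.basisOfKer x hx b (Sum.inl i) = x := by
  simp [LinearMap.basisOfKer, LinearMap.prodKerEquiv]

@[simp]
theorem LinearMap.basisOfKer_inr {F I : Type*} [AddCommGroup F] [Module S F]
    (φ : F →ₗ[S] S) (x : F) (hx : φ x = 1) (b : Module.Basis I S (LinearMap.ker φ)) (i : I) :
    φ.basisOfKer x hx b (Sum.inr i) = b i := by
  simp [LinearMap.basisOfKer, LinearMap.prodKerEquiv]

/-- The kernel is a direct summand of `F`, hence finite projective, hence free over a local ring. -/
theorem LinearMap.free_finite_ker [IsLocalRing S] {F : Type*} [AddCommGroup F] [Module S F]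
    [Module.Free S F] [Module.Finite S F] (φ : F →ₗ[S] S) (x : F) (hx : φ x = 1) :
    Module.Free S (LinearMap.ker φ) ∧ Module.Finite S (LinearMap.ker φ) ∧
      Module.finrank S F = Module.finrank S (LinearMap.ker φ) + 1 := by
  let E := φ.prodKerEquiv (LinearMap.toSpanSingleton S F x) (by simp [hx])
  let i : LinearMap.ker φ →ₗ[S] F := (LinearMap.ker φ).subtype
  let s : F →ₗ[S] LinearMap.ker φ := LinearMap.snd S S _ ∘ₗ E.symm.toLinearMap
  have his : s ∘ₗ i = LinearMap.id := by
    ext y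
    have h : φ (y : F) = 0 := y.2
    simp [s, i, E, LinearMap.prodKerEquiv, h]
  have hs : Function.Surjective s := fun y => ⟨i y, LinearMap.congr_fun his y⟩
  have h1 : Module.Projective S (LinearMap.ker φ) := Module.Projective.of_split i s his
  have h2 : Module.Finite S (LinearMap.ker φ) := Module.Finite.of_surjective s hs
  have h3 : Module.Free S (LinearMap.ker φ) := Module.free_of_flat_of_isLocalRing
  refine ⟨h3, h2, ?_⟩
  rw [← E.finrank_eq, Module.finrank_prod, Module.finrank_self, add_comm]

/-- The pair `(ρ, σ)` is in block form `(f, id) ⊕ (id, f) ⊕ (γ₁, γ₂)` with respect to bases. -/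
structure IsBlockForm {F G V U W : Type*} [AddCommGroup F] [Module S F] [AddCommGroup G]
    [Module S G] [Fintype W] (f : S) (ρ : G →ₗ[S] F) (σ : F →ₗ[S] G) (γ₁ γ₂ : Matrix W W S)
    (bF : Module.Basis (V ⊕ U ⊕ W) S F) (bG : Module.Basis (V ⊕ U ⊕ W) S G) : Prop where
  fst_left : ∀ i, ρ (bG (.inl i)) = f • bF (.inl i)
  fst_right : ∀ i, ρ (bG (.inr (.inl i))) = bF (.inr (.inl i))
  fst_rest : ∀ j, ρ (bG (.inr (.inr j))) = ∑ i, γ₁ i j • bF (.inr (.inr i))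
  snd_left : ∀ i, σ (bF (.inl i)) = bG (.inl i)
  snd_right : ∀ i, σ (bF (.inr (.inl i))) = f • bG (.inr (.inl i))
  snd_rest : ∀ j, σ (bF (.inr (.inr j))) = ∑ i, γ₂ i j • bG (.inr (.inr i))

/-- The pair `(ρ, σ)` has a block form whose last block is reduced. -/
def HasReducedBlockForm [IsLocalRing S] {F G : Type*} [AddCommGroup F] [Module S F]
    [AddCommGroup G] [Module S G] (f : S) (ρ : G →ₗ[S] F) (σ : F →ₗ[S] G) : Prop :=
  ∃ (V U W : Type) (_ : Fintype V) (_ : Fintype U) (_ : Fintype W) (γ₁ γ₂ : Matrix W W S)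
    (bF : Module.Basis (V ⊕ U ⊕ W) S F) (bG : Module.Basis (V ⊕ U ⊕ W) S G),
    IsBlockForm f ρ σ γ₁ γ₂ bF bG ∧ (∀ i j, γ₁ i j ∈ IsLocalRing.maximalIdeal S) ∧
      ∀ i j, γ₂ i j ∈ IsLocalRing.maximalIdeal S

theorem IsMatrixFactorization.symm {F G : Type*} [AddCommGroup F] [Module S F] [AddCommGroup G]
    [Module S G] {f : S} {ρ : G →ₗ[S] F} {σ : F →ₗ[S] G} (h : IsMatrixFactorization f ρ σ) :
    IsMatrixFactorization f σ ρ :=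
  ⟨h.free_right, h.finite_right, h.free_left, h.finite_left, h.finrank_eq.symm, h.comp_right,
    h.comp_left⟩

/-- Exchanging the maps exchanges the blocks `V` and `U`, so only unit entries of the first map need
treatment. -/
theorem HasReducedBlockForm.symm [IsLocalRing S] {F G : Type*} [AddCommGroup F] [Module S F]
    [AddCommGroup G] [Module S G] {f : S} {ρ : G →ₗ[S] F} {σ : F →ₗ[S] G}
    (h : HasReducedBlockForm f ρ σ) : HasReducedBlockForm f σ ρ := by
  obtain ⟨V, U, W, _, _, _, γ₁, γ₂, bF, bG, h, h₁, h₂⟩ := h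
  let ε : V ⊕ U ⊕ W ≃ U ⊕ V ⊕ W :=
    (Equiv.sumAssoc V U W).symm.trans (((Equiv.sumComm V U).sumCongr (Equiv.refl W)).trans
      (Equiv.sumAssoc U V W))
  refine ⟨U, V, W, inferInstance, inferInstance, inferInstance, γ₂, γ₁, bG.reindex ε,
    bF.reindex ε, ⟨fun i => ?_, fun i => ?_, fun i => ?_, fun i => ?_, fun i => ?_, fun i => ?_⟩,
    h₂, h₁⟩
  · simpa [ε] using h.snd_right i
  · simpa [ε] using h.snd_left i
  · simpa [ε] using h.snd_rest i
  · simpa [ε] using h.fst_right i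
  · simpa [ε] using h.fst_left i
  · simpa [ε] using h.fst_rest i

/-- A summand `(id, f)` can be split off a matrix factorization with a unit entry in the first
map. -/
theorem IsMatrixFactorization.hasReducedBlockForm_of_apply_eq_one [IsLocalRing S] {F G : Type u}
    [AddCommGroup F] [Module S F] [AddCommGroup G] [Module S G] {f : S} {ρ : G →ₗ[S] F}
    {σ : F →ₗ[S] G} (h : IsMatrixFactorization f ρ σ)
    (ih : ∀ (F' G' : Type u) [AddCommGroup F'] [Module S F'] [AddCommGroup G'] [Module S G']
      (ρ' : G' →ₗ[S] F') (σ' : F' →ₗ[S] G'), Module.finrank S F' < Module.finrank S F →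
      IsMatrixFactorization f ρ' σ' → HasReducedBlockForm f ρ' σ')
    (φ : F →ₗ[S] S) (g : G) (hg : φ (ρ g) = 1) : HasReducedBlockForm f ρ σ := by
  obtain ⟨_, _, _, _, hr, hρσ, hσρ⟩ := h
  have hρσ' (x : F) : ρ (σ x) = f • x := LinearMap.congr_fun hρσ x
  have hσρ' (x : G) : σ (ρ x) = f • x := LinearMap.congr_fun hσρ x
  -- The splittings F = S·ρ(g) ⊕ ker φ and G = S·g ⊕ ker(φρ) are respected by both maps, because
  -- σρ(g) = f g and φρσ = f φ.
  obtain ⟨hF₁, hF₂, hF₃⟩ := φ.free_finite_ker (ρ g) hg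
  obtain ⟨hG₁, hG₂, hG₃⟩ := (φ ∘ₗ ρ).free_finite_ker g hg
  let ρ' : LinearMap.ker (φ ∘ₗ ρ) →ₗ[S] LinearMap.ker φ := ρ.restrict fun x hx => hx
  let σ' : LinearMap.ker φ →ₗ[S] LinearMap.ker (φ ∘ₗ ρ) := σ.restrict fun x hx => by
    rw [LinearMap.mem_ker] at hx
    simp [hρσ', hx]
  have hρ' (x) : (ρ' x : F) = ρ x := rfl
  have hσ' (x) : (σ' x : G) = σ x := rfl
  obtain ⟨V, U, W, _, _, _, γ₁, γ₂, bF, bG, hb, h₁, h₂⟩ := ih _ _ ρ' σ' (by lia)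
    ⟨hF₁, hF₂, hG₁, hG₂, by lia, by ext x; simp [hρ', hσ', hρσ'], by ext x; simp [hρ', hσ', hσρ']⟩
  let ε : Unit ⊕ V ⊕ U ⊕ W ≃ V ⊕ (Unit ⊕ U) ⊕ W :=
    (Equiv.sumAssoc Unit V (U ⊕ W)).symm.trans (((Equiv.sumComm Unit V).sumCongr
      (Equiv.refl (U ⊕ W))).trans ((Equiv.sumAssoc V Unit (U ⊕ W)).trans
        ((Equiv.refl V).sumCongr (Equiv.sumAssoc Unit U W).symm)))
  refine ⟨V, Unit ⊕ U, W, inferInstance, inferInstance, inferInstance, γ₁, γ₂,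
    (φ.basisOfKer (ρ g) hg bF).reindex ε, ((φ ∘ₗ ρ).basisOfKer g hg bG).reindex ε,
    ⟨fun i => ?_, ?_, fun i => ?_, fun i => ?_, ?_, fun i => ?_⟩, h₁, h₂⟩
  · simpa [ε, hρ'] using congrArg Subtype.val (hb.fst_left i)
  · rintro (i | i)
    · simp [ε]
    · simpa [ε, hρ'] using congrArg Subtype.val (hb.fst_right i)
  · simpa [ε, hρ'] using congrArg Subtype.val (hb.fst_rest i)
  · simpa [ε, hσ'] using congrArg Subtype.val (hb.snd_left i)
  · rintro (i | i)
    · simp [ε, hσρ']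
    · simpa [ε, hσ'] using congrArg Subtype.val (hb.snd_right i)
  · simpa [ε, hσ'] using congrArg Subtype.val (hb.snd_rest i)

/-- Induction on the rank. Unit entries are detected without bases, as values φ(ρ g) or φ(σ g)
outside 𝔪; if there are none, the pair is reduced in any bases. -/
theorem IsMatrixFactorization.hasReducedBlockForm [IsLocalRing S] {F G : Type u}
    [AddCommGroup F] [Module S F] [AddCommGroup G] [Module S G] {f : S} {ρ : G →ₗ[S] F}
    {σ : F →ₗ[S] G} (h : IsMatrixFactorization f ρ σ) : HasReducedBlockForm f ρ σ := by
  induction hN : Module.finrank S F using Nat.strong_induction_on generalizing F G with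
  | _ N ih =>
  subst hN
  have hscale {H K : Type u} [AddCommGroup H] [Module S H] [AddCommGroup K] [Module S K]
      (τ : H →ₗ[S] K) (φ : K →ₗ[S] S) (g : H) (hu : φ (τ g) ∉ IsLocalRing.maximalIdeal S) :
      ∃ g, φ (τ g) = 1 := by
    obtain ⟨c, hc⟩ := (IsLocalRing.notMem_maximalIdeal.1 hu).exists_left_inv
    exact ⟨c • g, by simpa using hc⟩
  by_cases h₁ : ∃ (φ : F →ₗ[S] S) (g : G), φ (ρ g) ∉ IsLocalRing.maximalIdeal S
  · obtain ⟨φ, g, hu⟩ := h₁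
    obtain ⟨g, hg⟩ := hscale ρ φ g hu
    exact h.hasReducedBlockForm_of_apply_eq_one (fun F' G' _ _ _ _ ρ' σ' hlt h' =>
      ih _ hlt h' rfl) φ g hg
  by_cases h₂ : ∃ (φ : G →ₗ[S] S) (g : F), φ (σ g) ∉ IsLocalRing.maximalIdeal S
  · obtain ⟨φ, g, hu⟩ := h₂
    obtain ⟨g, hg⟩ := hscale σ φ g hu
    refine (h.symm.hasReducedBlockForm_of_apply_eq_one (fun F' G' _ _ _ _ ρ' σ' hlt h' => ?_)
      φ g hg).symm
    exact ih _ (h.finrank_eq ▸ hlt) h' rfl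
  push Not at h₁ h₂
  obtain ⟨_, _, _, _, hr, hρσ, hσρ⟩ := h
  let ε : Fin (Module.finrank S F) ≃ Empty ⊕ Empty ⊕ Fin (Module.finrank S F) :=
    ((Equiv.emptySum Empty _).trans (Equiv.emptySum Empty _)).symm
  let bF := Module.finBasis S F
  let bG := (Module.finBasis S G).reindex (finCongr hr.symm)
  refine ⟨Empty, Empty, Fin (Module.finrank S F), inferInstance, inferInstance, inferInstance,
    fun i j => bF.coord i (ρ (bG j)), fun i j => bG.coord i (σ (bF j)), bF.reindex ε,
    bG.reindex ε, ⟨fun i => i.elim, fun i => i.elim, fun j => ?_, fun i => i.elim,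
      fun i => i.elim, fun j => ?_⟩, fun i j => h₁ _ _, fun i j => h₂ _ _⟩
  · simp [ε, bF.sum_repr]
  · simp [ε, bG.sum_repr]

section Matrix

variable {F G : Type*} [AddCommGroup F] [Module S F] [AddCommGroup G] [Module S G] {f : S}
  {ρ : G →ₗ[S] F} {σ : F →ₗ[S] G} {v u r : ℕ} {γ : MatrixPair S (Fin r)}
  {bF : Module.Basis (Fin v ⊕ Fin u ⊕ Fin r) S F} {bG : Module.Basis (Fin v ⊕ Fin u ⊕ Fin r) S G}

theorem isBlockForm_of_toMatrix (h : (LinearMap.toMatrix bG bF ρ, LinearMap.toMatrix bF bG σ) =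
      (MatrixPair.trivialLeft f v).directSum ((MatrixPair.trivialRight f u).directSum γ)) :
    IsBlockForm f ρ σ γ.1 γ.2 bF bG := by
  obtain ⟨h₁, h₂⟩ := Prod.ext_iff.1 h
  have hρ (j) : ρ (bG j) = ∑ i, (LinearMap.toMatrix bG bF ρ) i j • bF i := by
    simp_rw [LinearMap.toMatrix_apply]
    exact (bF.sum_repr _).symm
  have hσ (j) : σ (bF j) = ∑ i, (LinearMap.toMatrix bF bG σ) i j • bG i := by
    simp_rw [LinearMap.toMatrix_apply]
    exact (bG.sum_repr _).symm
  simp only [MatrixPair.directSum, MatrixPair.trivialLeft, MatrixPair.trivialRight] at h₁ h₂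
  rw [h₁] at hρ
  rw [h₂] at hσ
  constructor <;> intro j <;> simp [hρ, hσ, Matrix.diagonal_apply, Matrix.one_apply]

theorem IsBlockForm.toMatrix_eq (h : IsBlockForm f ρ σ γ.1 γ.2 bF bG) :
    (LinearMap.toMatrix bG bF ρ, LinearMap.toMatrix bF bG σ) =
      (MatrixPair.trivialLeft f v).directSum ((MatrixPair.trivialRight f u).directSum γ) := by
  classical
  refine Prod.ext (Matrix.ext fun i j => ?_) (Matrix.ext fun i j => ?_) <;>
  rcases j with j | j | j <;> rcases i with i | i | i <;>
  simp [MatrixPair.directSum, MatrixPair.trivialLeft, MatrixPair.trivialRight,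
    LinearMap.toMatrix_apply, h.fst_left, h.fst_right, h.fst_rest, h.snd_left, h.snd_right,
    h.snd_rest, Matrix.diagonal_apply, Matrix.one_apply, Finsupp.single_apply, eq_comm]

end Matrix

theorem IsMatrixFactorization.exists_isMFDecomposition [IsLocalRing S] {F G : Type u}
    [AddCommGroup F] [Module S F] [AddCommGroup G] [Module S G] {f : S} {ρ : G →ₗ[S] F}
    {σ : F →ₗ[S] G} (h : IsMatrixFactorization f ρ σ) :
    ∃ (v u r : ℕ) (γ : MatrixPair S (Fin r)), IsMFDecomposition f ρ σ v u γ := by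
  obtain ⟨V, U, W, _, _, _, γ₁, γ₂, bF, bG, hb, h₁, h₂⟩ := h.hasReducedBlockForm
  let εV := Fintype.equivFin V
  let εU := Fintype.equivFin U
  let εW := Fintype.equivFin W
  let ε := εV.sumCongr (εU.sumCongr εW)
  let γ : MatrixPair S (Fin (Fintype.card W)) :=
    (γ₁.submatrix εW.symm εW.symm, γ₂.submatrix εW.symm εW.symm)
  have hB : IsBlockForm f ρ σ γ.1 γ.2 (bF.reindex ε) (bG.reindex ε) := by
    refine ⟨fun i => ?_, fun i => ?_, fun i => ?_, fun i => ?_, fun i => ?_, fun i => ?_⟩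
    · simp [ε, hb.fst_left]
    · simp [ε, hb.fst_right]
    · simp only [ε, Module.Basis.reindex_apply, Equiv.sumCongr_symm, Equiv.sumCongr_apply,
        Sum.map_inr, hb.fst_rest, γ, Matrix.submatrix_apply]
      exact (εW.symm.sum_comp fun j => γ₁ j (εW.symm i) • bF (.inr (.inr j))).symm
    · simp [ε, hb.snd_left]
    · simp [ε, hb.snd_right]
    · simp only [ε, Module.Basis.reindex_apply, Equiv.sumCongr_symm, Equiv.sumCongr_apply,
        Sum.map_inr, hb.snd_rest, γ, Matrix.submatrix_apply]
      exact (εW.symm.sum_comp fun j => γ₂ j (εW.symm i) • bG (.inr (.inr j))).symm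
  have hM := hB.toMatrix_eq
  have hM₁ : LinearMap.toMatrix (bG.reindex ε) (bF.reindex ε) ρ = _ := congrArg Prod.fst hM
  have hM₂ : LinearMap.toMatrix (bF.reindex ε) (bG.reindex ε) σ = _ := congrArg Prod.snd hM
  refine ⟨_, _, _, γ, ⟨?_, ?_, fun i j => h₁ _ _, fun i j => h₂ _ _⟩, _, _, hM⟩
  -- The relation for γ₁γ₂ is the last diagonal block of ρσ = f • id; the one for γ₂γ₁ comes
  -- likewise from σρ.
  · have h3 := LinearMap.toMatrix_comp (bF.reindex ε) (bG.reindex ε) (bF.reindex ε) ρ σ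
    rw [h.comp_left, map_smul, LinearMap.toMatrix_id, hM₁, hM₂] at h3
    ext i j
    have := congrFun (congrFun h3 (.inr (.inr i))) (.inr (.inr j))
    simp [MatrixPair.directSum, MatrixPair.trivialLeft, MatrixPair.trivialRight,
      Matrix.fromBlocks_multiply, Matrix.diagonal_apply, Matrix.one_apply] at this ⊢
    exact this.symm
  · have h3 := LinearMap.toMatrix_comp (bG.reindex ε) (bF.reindex ε) (bG.reindex ε) σ ρ
    rw [h.comp_right, map_smul, LinearMap.toMatrix_id, hM₁, hM₂] at h3
    ext i j
    have := congrFun (congrFun h3 (.inr (.inr i))) (.inr (.inr j))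
    simp [MatrixPair.directSum, MatrixPair.trivialLeft, MatrixPair.trivialRight,
      Matrix.fromBlocks_multiply, Matrix.diagonal_apply, Matrix.one_apply] at this ⊢
    exact this.symm

end Splitting

/-! ### Uniqueness of the free rank -/

section FreeSummands

variable {A M N : Type*} [CommRing A] [IsLocalRing A] [AddCommGroup M] [Module A M]
  [AddCommGroup N] [Module A N]

/-- A functional with a unit value is, after scaling the argument, a split surjection onto `A`. -/
theorem not_hasFreeSummand_one_iff :
    ¬ HasFreeSummand A N 1 ↔ ∀ (χ : N →ₗ[A] A) (x : N), χ x ∈ IsLocalRing.maximalIdeal A := by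
  rw [not_iff_comm]
  push Not
  constructor
  · rintro ⟨χ, x, hx⟩
    obtain ⟨c, hc⟩ := (IsLocalRing.notMem_maximalIdeal.1 hx).exists_left_inv
    let E := χ.prodKerEquiv (LinearMap.toSpanSingleton A N (c • x)) (by simp [hc])
    exact ⟨LinearMap.ker χ, ⟨E.symm.trans
      ((LinearEquiv.funUnique (Fin 1) A A).symm.prodCongr (LinearEquiv.refl A _))⟩⟩
  · rintro ⟨N', ⟨E⟩⟩
    refine ⟨LinearMap.proj 0 ∘ₗ LinearMap.fst A _ _ ∘ₗ E.toLinearMap, E.symm (1, 0), ?_⟩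
    simp [IsLocalRing.mem_maximalIdeal]

/-- The free part of a direct sum decomposition is at most as large as the free part of a
decomposition whose complement has no free direct summand. -/
theorem le_of_linearEquiv_prod {N' : Type*} [AddCommGroup N'] [Module A N'] {a b : ℕ}
    (Ea : M ≃ₗ[A] (Fin a → A) × N') (Eb : M ≃ₗ[A] (Fin b → A) × N)
    (hN : ¬ HasFreeSummand A N 1) : a ≤ b := by
  rw [not_hasFreeSummand_one_iff] at hN
  let P : (Fin b → A) × N →ₗ[A] (Fin a → A) :=
    LinearMap.fst A _ _ ∘ₗ (Eb.symm.trans Ea).toLinearMap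
  let T : (Fin b → A) →ₗ[A] (Fin a → A) := P ∘ₗ LinearMap.inl A _ _
  refine le_of_fin_surjective A T (LinearMap.range_eq_top.1 (top_le_iff.1 ?_))
  -- Nakayama: all functionals on `N` have values in 𝔪, so modulo 𝔪 the free part of rank `b`
  -- already surjects onto A^a.
  refine Submodule.le_of_le_smul_of_le_jacobson_bot (I := IsLocalRing.maximalIdeal A)
    Module.Finite.fg_top (IsLocalRing.maximalIdeal_le_jacobson ⊥) fun y _ => ?_
  obtain ⟨⟨c, z⟩, hz⟩ := (Eb.symm.trans Ea).surjective (y, 0)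
  have hy : y = T c + P (0, z) := by
    have : y = P (c, z) := by simp only [P, LinearMap.comp_apply, LinearEquiv.coe_coe, hz]; rfl
    rw [this]
    change P (c, z) = P (c, 0) + P (0, z)
    rw [← map_add]
    simp
  rw [hy]
  refine Submodule.add_mem_sup ⟨c, rfl⟩ ?_
  rw [(Pi.basisFun A (Fin a)).mem_ideal_smul_top_iff]
  intro i
  exact hN (LinearMap.proj i ∘ₗ P ∘ₗ LinearMap.inr A _ _) z

theorem IsFreeRank.iff_eq {v : ℕ} (h : IsFreeRank A M v) (a : ℕ) : IsFreeRank A M a ↔ a = v := by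
  refine ⟨fun h' => ?_, fun h' => h' ▸ h⟩
  obtain ⟨N, ⟨E⟩, hN⟩ := h
  obtain ⟨N', ⟨E'⟩, hN'⟩ := h'
  exact le_antisymm (le_of_linearEquiv_prod E' E hN) (le_of_linearEquiv_prod E E' hN')

theorem IsFreeRank.isGreatest {v : ℕ} (h : IsFreeRank A M v) :
    IsGreatest {a : ℕ | HasFreeSummand A M a} v := by
  obtain ⟨N, ⟨E⟩, hN⟩ := h
  refine ⟨⟨N, ⟨E⟩⟩, ?_⟩
  rintro a ⟨N', ⟨E'⟩⟩
  exact le_of_linearEquiv_prod E' E hN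

end FreeSummands

/-! ### Descent to the hypersurface ring -/

theorem LinearMap.exists_semilinear_lift {S A F F' N : Type*} [CommRing S] [CommRing A]
    [AddCommGroup F] [Module S F] [AddCommGroup F'] [Module A F'] [AddCommGroup N] [Module A N]
    {τ : S →+* A} (hτ : Function.Surjective τ) (π : F →ₛₗ[τ] F') (hπ : Function.Surjective π)
    (ψ : F →ₛₗ[τ] N) (h : ∀ x, π x = 0 → ψ x = 0) :
    ∃ Φ : F' →ₗ[A] N, ∀ x, Φ (π x) = ψ x := by
  have hwd {x y : F} (hxy : π x = π y) : ψ x = ψ y := by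
    rw [← sub_eq_zero, ← map_sub] at hxy ⊢
    exact h _ hxy
  have hs := Function.surjInv_eq hπ
  refine ⟨{ toFun := fun x => ψ (Function.surjInv hπ x), map_add' := fun x y => ?_,
            map_smul' := fun a x => ?_ }, fun x => hwd (hs _)⟩
  · rw [← map_add]
    exact hwd (by rw [map_add, hs, hs, hs])
  · obtain ⟨s, rfl⟩ := hτ a
    rw [RingHom.id_apply, ← map_smulₛₗ]
    exact hwd (by rw [map_smulₛₗ, hs, hs])

namespace FrobPush

variable {S : Type*} [CommRing S] (p e : ℕ) [Fact p.Prime] [CharP S p]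

/-- The map `F^e_* S → F^e_* (S ⧸ I)`. -/
noncomputable def mk (I : Ideal S) [CharP (S ⧸ I) p] :
    FrobPush p e S →ₛₗ[Ideal.Quotient.mk I] FrobPush p e (S ⧸ I) where
  toFun x := of p e _ (Ideal.Quotient.mk I ((of p e S).symm x))
  map_add' x y := by simp
  map_smul' a x := by
    obtain ⟨s, rfl⟩ := (of p e S).surjective x
    simp [smul_of]

theorem mk_of (I : Ideal S) [CharP (S ⧸ I) p] (s : S) :
    mk p e I (of p e S s) = of p e _ (Ideal.Quotient.mk I s) := rfl

theorem mk_surjective (I : Ideal S) [CharP (S ⧸ I) p] :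
    Function.Surjective (mk p e I) := by
  intro x
  obtain ⟨a, rfl⟩ := (of p e _).surjective x
  obtain ⟨s, rfl⟩ := Ideal.Quotient.mk_surjective a
  exact ⟨of p e S s, rfl⟩

/-- This presents F^e_*(S/f) as the cokernel of F^e_*(f). -/
theorem mk_eq_zero_iff (f : S) [CharP (S ⧸ Ideal.span {f}) p] (x : FrobPush p e S) :
    mk p e (Ideal.span {f}) x = 0 ↔ x ∈ LinearMap.range (mul p e f) := by
  obtain ⟨s, rfl⟩ := (of p e S).surjective x
  rw [mk_of, EmbeddingLike.map_eq_zero_iff, Ideal.Quotient.eq_zero_iff_mem,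
    Ideal.mem_span_singleton']
  constructor
  · rintro ⟨c, rfl⟩
    exact ⟨of p e S c, by rw [mul_of, mul_comm]⟩
  · rintro ⟨y, hy⟩
    obtain ⟨y, rfl⟩ := (of p e S).surjective y
    exact ⟨y, by rw [mul_comm]; exact hy⟩

theorem isMatrixFactorization {ι : Type*} [Fintype ι]
    (b : Module.Basis ι S (FrobPush p e S)) (f : S) :
    IsMatrixFactorization f (mul p e f) (mul p e (f ^ (p ^ e - 1))) := by
  have hq : p ^ e - 1 + 1 = p ^ e := Nat.sub_add_cancel (pow_pos (Fact.out : p.Prime).pos e)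
  have hfree : Module.Free S (FrobPush p e S) := .of_basis b
  have hfin : Module.Finite S (FrobPush p e S) := .of_basis b
  refine ⟨hfree, hfin, hfree, hfin, rfl, ?_, ?_⟩
  · ext x
    obtain ⟨s, rfl⟩ := (of p e S).surjective x
    simp [smul_of, ← mul_assoc, ← pow_succ', hq]
  · ext x
    obtain ⟨s, rfl⟩ := (of p e S).surjective x
    simp [smul_of, ← mul_assoc, ← pow_succ, hq]

end FrobPush

/-! ### Reading invariants off a decomposition -/

section Decompositions

variable {S : Type*} [CommRing S] [IsLocalRing S]

/-- On the first block `σ` is the identity; its other entries are `f` or entries of `γ₂`, all in 𝔪.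
-/
theorem IsBlockForm.mem_range_sup_smul_top_iff {F G V U W : Type*} [AddCommGroup F] [Module S F]
    [AddCommGroup G] [Module S G] [Fintype V] [Fintype U] [Fintype W] {f : S} {ρ : G →ₗ[S] F}
    {σ : F →ₗ[S] G} {γ₁ γ₂ : Matrix W W S} {bF : Module.Basis (V ⊕ U ⊕ W) S F}
    {bG : Module.Basis (V ⊕ U ⊕ W) S G} (h : IsBlockForm f ρ σ γ₁ γ₂ bF bG)
    (hf : f ∈ IsLocalRing.maximalIdeal S) (hγ : ∀ i j, γ₂ i j ∈ IsLocalRing.maximalIdeal S)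
    (x : G) : x ∈ LinearMap.range σ ⊔ IsLocalRing.maximalIdeal S • (⊤ : Submodule S G) ↔
      ∀ i, bG.repr x (.inr i) ∈ IsLocalRing.maximalIdeal S := by
  constructor
  · intro hx i
    obtain ⟨_, ⟨y, rfl⟩, z, hz, rfl⟩ := Submodule.mem_sup.1 hx
    rw [map_add, Finsupp.add_apply]
    refine add_mem ?_ ((bG.mem_ideal_smul_top_iff _ z).1 hz _)
    rw [← bF.sum_repr y]
    simp only [map_sum, map_smul, Finsupp.finsetSum_apply, Finsupp.smul_apply, smul_eq_mul]
    refine Ideal.sum_mem _ fun j _ => Ideal.mul_mem_left _ _ ?_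
    rcases j with j | j | j
    · simp [h.snd_left]
    · rw [h.snd_right, map_smul]
      exact Ideal.mul_mem_right _ _ hf
    · rw [h.snd_rest]
      simp only [map_sum, map_smul, Finsupp.finsetSum_apply, Finsupp.smul_apply, smul_eq_mul]
      exact Ideal.sum_mem _ fun l _ => Ideal.mul_mem_right _ _ (hγ _ _)
  · intro hx
    rw [← bG.sum_repr x, Fintype.sum_sum_type]
    refine Submodule.add_mem_sup (Submodule.sum_mem _ fun i _ => ?_)
      (Submodule.sum_mem _ fun i _ => Submodule.smul_mem_smul (hx i) trivial)
    rw [← h.snd_left]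
    exact Submodule.smul_mem _ _ ⟨_, rfl⟩

namespace FrobPush

variable (p e : ℕ) [Fact p.Prime]

theorem submodule_idealPowAdd [CharP S p] (f : S) (t : ℕ) :
    submodule p e (idealPowAdd p f e t) = LinearMap.range (mul p e (f ^ t)) ⊔
      IsLocalRing.maximalIdeal S • ⊤ := by
  rw [← submodule_map_iterateFrobenius, idealPowAdd_eq]
  ext x
  obtain ⟨s, rfl⟩ := (of p e S).surjective x
  rw [of_mem_submodule, Submodule.mem_sup, Submodule.mem_sup]
  constructor
  · rintro ⟨y, hy, z, hz, rfl⟩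
    obtain ⟨c, rfl⟩ := Ideal.mem_span_singleton'.1 hy
    exact ⟨of p e S (c * f ^ t), ⟨of p e S c, by rw [mul_of, mul_comm]⟩, of p e S z, hz, rfl⟩
  · rintro ⟨_, ⟨y, rfl⟩, z, hz, hyz⟩
    obtain ⟨y, rfl⟩ := (of p e S).surjective y
    exact ⟨f ^ t * y, Ideal.mul_mem_right _ _ (Ideal.mem_span_singleton_self _),
      (of p e S).symm z, hz, hyz⟩

end FrobPush

variable {p e : ℕ} [Fact p.Prime] [CharP S p] {f : S} {v u r : ℕ} {γ : MatrixPair S (Fin r)}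

theorem IsMFDecomposition.eq_length_moduleM (hf : f ∈ IsLocalRing.maximalIdeal S)
    (h : ∀ b : S, ∃ a : S, b - a ^ p ^ e ∈ IsLocalRing.maximalIdeal S)
    (hd : IsMFDecomposition f (FrobPush.mul p e f) (FrobPush.mul p e (f ^ (p ^ e - 1))) v u γ) :
    (v : ℕ∞) = Module.length S (ModuleM p f e (p ^ e - 1)) := by
  obtain ⟨hγ, bF, bG, hb⟩ := hd
  have hB := isBlockForm_of_toMatrix hb
  have h₁ := length_quotient_idealPowAdd_pow p e bG h hf
  have h₂ := bG.length_quotient_of_mem_iff Function.Embedding.inr (IsLocalRing.maximalIdeal S) _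
    (hB.mem_range_sup_smul_top_iff hf hγ.snd_mem)
  rw [← FrobPush.submodule_idealPowAdd, FrobPush.length_quotient_submodule p e h,
    length_quotient_maximalIdeal, mul_one] at h₂
  rw [length_quotient_idealPowAdd_pow_sub_one, h₂, Fintype.card_sum (α := Fin v), Nat.cast_add,
    Fintype.card_fin] at h₁
  exact (ENat.add_left_injective_of_ne_top (ENat.natCast_ne_top _) h₁).symm

theorem IsMFDecomposition.isFreeRank [IsDomain S] (hf0 : f ≠ 0)
    [CharP (S ⧸ Ideal.span {f}) p]
    (hd : IsMFDecomposition f (FrobPush.mul p e f) (FrobPush.mul p e (f ^ (p ^ e - 1))) v u γ) :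
    IsFreeRank (S ⧸ Ideal.span {f}) (FrobPush p e (S ⧸ Ideal.span {f})) v := by
  obtain ⟨hγ, bF, bG, hb⟩ := hd
  have hB := isBlockForm_of_toMatrix hb
  have hrange (x : FrobPush p e S) (hx : FrobPush.mk p e (Ideal.span {f}) x = 0) :=
    (FrobPush.mk_eq_zero_iff p e f x).1 hx
  have hρ0 (y : FrobPush p e S) : FrobPush.mk p e (Ideal.span {f}) (FrobPush.mul p e f y) = 0 :=
    (FrobPush.mk_eq_zero_iff p e f _).2 ⟨y, rfl⟩
  have hρσ (x : FrobPush p e S) :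
      FrobPush.mul p e f (FrobPush.mul p e (f ^ (p ^ e - 1)) x) = f • x :=
    LinearMap.congr_fun (FrobPush.isMatrixFactorization p e bF f).comp_left x
  have hnt : Nontrivial (S ⧸ Ideal.span {f}) := CharP.nontrivial_of_char_ne_one
    (Fact.out : p.Prime).ne_one
  have hloc : IsLocalRing (S ⧸ Ideal.span {f}) :=
    IsLocalRing.of_surjective' _ Ideal.Quotient.mk_surjective
  set τ := Ideal.Quotient.mk (Ideal.span {f}) with hτ
  set π := FrobPush.mk p e (Ideal.span {f}) with hπ
  -- The first-block coordinates modulo `f` vanish on the image of F^e_*(f), so they descend to the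
  -- projection `Φ` onto (S/f)^v.
  let ψ : FrobPush p e S →ₛₗ[τ] (Fin v → S ⧸ Ideal.span {f}) :=
    { toFun := fun x i => τ (bF.repr x (.inl i))
      map_add' := fun x y => by ext i; simp
      map_smul' := fun a x => by ext i; simp }
  obtain ⟨Φ, hΦ⟩ := LinearMap.exists_semilinear_lift Ideal.Quotient.mk_surjective π
    (FrobPush.mk_surjective p e _) ψ (by
      intro x hx
      obtain ⟨y, rfl⟩ := hrange x hx
      funext i
      change τ _ = 0
      rw [hτ, Ideal.Quotient.eq_zero_iff_mem, ← bG.sum_repr y]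
      simp only [map_sum, map_smul, Finsupp.finsetSum_apply, Finsupp.smul_apply, smul_eq_mul]
      refine Ideal.sum_mem _ fun j _ => Ideal.mul_mem_left _ _ ?_
      rcases j with j | j | j
      · rw [hB.fst_left, map_smul]
        exact Ideal.mul_mem_right _ _ (Ideal.mem_span_singleton_self f)
      · simp [hB.fst_right]
      · simp [hB.fst_rest])
  let Ψ : (Fin v → S ⧸ Ideal.span {f}) →ₗ[S ⧸ Ideal.span {f}]
      FrobPush p e (S ⧸ Ideal.span {f}) :=
    Fintype.linearCombination _ fun i => π (bF (.inl i))
  have hΨ (i : Fin v) : Ψ (Pi.single i 1) = π (bF (.inl i)) := by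
    simp [Ψ, Fintype.linearCombination_apply_single]
  have hΦΨ (y) : Φ (Ψ y) = y := by
    refine LinearMap.congr_fun (f := Φ ∘ₗ Ψ) (g := LinearMap.id) ?_ y
    refine (Pi.basisFun _ _).ext fun i => ?_
    rw [LinearMap.comp_apply, Pi.basisFun_apply, hΨ, hΦ]
    funext j
    change τ (bF.repr (bF (.inl i)) (.inl j)) = _
    rw [bF.repr_self, Finsupp.single_apply, LinearMap.id_apply, Pi.single_apply]
    simp only [Sum.inl.injEq, eq_comm (a := j)]
    split_ifs <;> simp
  refine ⟨LinearMap.ker Φ, ⟨(Φ.prodKerEquiv Ψ hΦΨ).symm⟩, not_hasFreeSummand_one_iff.2 ?_⟩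
  intro χ x
  -- The functional is extended by zero on the free part, then lifted to `φ` on F^e_*S through the
  -- basis `bF`.
  let χ' : FrobPush p e (S ⧸ Ideal.span {f}) →ₗ[S ⧸ Ideal.span {f}] S ⧸ Ideal.span {f} :=
    χ ∘ₗ LinearMap.snd _ _ _ ∘ₗ (Φ.prodKerEquiv Ψ hΦΨ).symm.toLinearMap
  have hχ' : χ x = χ' x := by
    have : (Φ.prodKerEquiv Ψ hΦΨ).symm x = (0, x) := by
      rw [LinearEquiv.symm_apply_eq]
      simp [LinearMap.prodKerEquiv]
    simp [χ', this]
  have hχΨ (y) : χ' (Ψ y) = 0 := by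
    have : (Φ.prodKerEquiv Ψ hΦΨ).symm (Ψ y) = (y, 0) := by
      rw [LinearEquiv.symm_apply_eq]
      simp [LinearMap.prodKerEquiv]
    simp [χ', this]
  choose c hc using fun j => Ideal.Quotient.mk_surjective (I := Ideal.span {f}) (χ' (π (bF j)))
  let φ : FrobPush p e S →ₗ[S] S := bF.constr S c
  have hφ (s : FrobPush p e S) : τ (φ s) = χ' (π s) := by
    conv_rhs => rw [← bF.sum_repr s]
    simp only [φ, Module.Basis.constr_apply_fintype, map_sum, map_smulₛₗ, smul_eq_mul, map_mul,
      Module.Basis.equivFun_apply, RingHom.id_apply, ← hc]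
    rfl
  -- Since `χ'` kills the class of F^e_*(f) y, the lift `φ` takes a multiple of `f` there.
  have hd (y : FrobPush p e S) : ∃ d, f * d = φ (FrobPush.mul p e f y) := by
    have h0 := hφ (FrobPush.mul p e f y)
    rw [hρ0, map_zero, hτ, Ideal.Quotient.eq_zero_iff_mem, Ideal.mem_span_singleton] at h0
    obtain ⟨d, hd⟩ := h0
    exact ⟨d, hd.symm⟩
  choose d hd using hd
  obtain ⟨s, hs⟩ := FrobPush.mk_surjective p e (Ideal.span {f}) x
  rw [hχ', ← hs, ← bF.sum_repr s, map_sum, map_sum]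
  refine Ideal.sum_mem _ fun i _ => ?_
  rw [map_smulₛₗ, map_smul, smul_eq_mul]
  refine Ideal.mul_mem_left _ _ ?_
  rcases i with i | i | i
  · rw [← hπ, ← hΨ, hχΨ]
    exact zero_mem _
  · rw [← hB.fst_right, hρ0, map_zero]
    exact zero_mem _
  -- Evaluating `φ` on `f • bF` = ρ(σ(bF)) and cancelling `f` in the domain `S` gives c = d γ₂,
  -- whose entries lie in 𝔪.
  · have hci : c (.inr (.inr i)) = ∑ j, γ.2 j i * d (bG (.inr (.inr j))) := by
      apply mul_left_cancel₀ hf0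
      have h1 : φ (f • bF (.inr (.inr i))) = f * c (.inr (.inr i)) := by
        simp [φ]
      rw [← h1, ← hρσ, hB.snd_rest]
      simp only [map_sum, map_smul, smul_eq_mul, ← hd, Finset.mul_sum]
      exact Finset.sum_congr rfl fun j _ => by ring
    have hcm : c (.inr (.inr i)) ∈ IsLocalRing.maximalIdeal S :=
      hci ▸ Ideal.sum_mem _ fun j _ => Ideal.mul_mem_right _ _ (hγ.snd_mem _ _)
    rw [← hπ, ← hc]
    have : IsLocalHom τ := IsLocalHom.of_surjective _ Ideal.Quotient.mk_surjective
    exact map_nonunit τ _ hcm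

end Decompositions

/-! ### Dimension and limits for power series rings -/

namespace MvPowerSeries

theorem ringKrullDim_fin (k : Type*) [Field k] (n : ℕ) :
    ringKrullDim (MvPowerSeries (Fin n) k) = n := by
  induction n with
  | zero =>
    rw [ringKrullDim_eq_of_ringEquiv (isEmptyEquiv (σ := Fin 0) k).toRingEquiv]
    simp
  | succ n ih =>
    rw [ringKrullDim_eq_of_ringEquiv (finSuccEquiv k n).toRingEquiv]
    let A := MvPowerSeries (Fin n) k
    have hX : (PowerSeries.X : PowerSeries A) ∈ IsLocalRing.maximalIdeal (PowerSeries A) := by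
      rw [IsLocalRing.mem_maximalIdeal, mem_nonunits_iff, PowerSeries.isUnit_iff_constantCoeff]
      simp
    rw [← ringKrullDim_quotient_span_singleton_succ_eq_ringKrullDim_of_mem_nonZeroDivisors
      (mem_nonZeroDivisors_of_ne_zero PowerSeries.X_ne_zero) hX]
    have hker : RingHom.ker (PowerSeries.constantCoeff (R := A)) = Ideal.span {PowerSeries.X} := by
      ext x
      rw [RingHom.mem_ker, Ideal.mem_span_singleton, PowerSeries.X_dvd_iff]
    rw [ringKrullDim_eq_of_ringEquiv ((Ideal.quotEquivOfEq hker.symm).trans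
      (RingHom.quotientKerEquivOfSurjective PowerSeries.constantCoeff_surj)), ih]
    rfl

theorem exists_sub_pow_mem_maximalIdeal {σ k : Type*} [Field k] (p e : ℕ) [Fact p.Prime]
    [CharP k p] [PerfectRing k p] (b : MvPowerSeries σ k) :
    ∃ a : MvPowerSeries σ k, b - a ^ p ^ e ∈ IsLocalRing.maximalIdeal (MvPowerSeries σ k) := by
  obtain ⟨c, hc⟩ := (iterateFrobeniusEquiv k p e).surjective (constantCoeff b)
  rw [iterateFrobeniusEquiv_def] at hc
  refine ⟨C c, ?_⟩
  rw [IsLocalRing.mem_maximalIdeal, mem_nonunits_iff, isUnit_iff_constantCoeff]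
  simp [hc]

theorem length_moduleM_ne_top {k : Type*} [Field k] (p : ℕ) [Fact p.Prime] [CharP k p]
    [PerfectRing k p] {n : ℕ} {f : MvPowerSeries (Fin (n + 1)) k}
    (hf : f ∈ IsLocalRing.maximalIdeal (MvPowerSeries (Fin (n + 1)) k)) (e : ℕ) :
    Module.length (MvPowerSeries (Fin (n + 1)) k) (ModuleM p f e (p ^ e - 1)) ≠ ⊤ := by
  have h := length_quotient_idealPowAdd_pow p e (frobPushBasis p e)
    (exists_sub_pow_mem_maximalIdeal p e) hf
  rw [length_quotient_idealPowAdd_pow_sub_one] at h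
  intro htop
  rw [htop, top_add] at h
  exact ENat.natCast_ne_top _ h.symm

/-- F_*R has rank p^(n+1); the factor `p` on the left of `mul_length_moduleM_succ_le` leaves p^n,
exactly the growth of the normalization. -/
theorem coeffC_pow_sub_one_antitone {k : Type*} [Field k] (p : ℕ) [Fact p.Prime] [CharP k p]
    [PerfectRing k p] {n : ℕ} {f : MvPowerSeries (Fin (n + 1)) k}
    (hf : f ∈ IsLocalRing.maximalIdeal (MvPowerSeries (Fin (n + 1)) k)) :
    Antitone fun e : ℕ => coeffC p f e (p ^ e - 1) := by
  refine antitone_nat_of_succ_le fun e => ?_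
  have hp : 0 < (p : ℝ) := Nat.cast_pos.2 (Fact.out : p.Prime).pos
  have h := mul_length_moduleM_succ_le p e (frobPushBasis p 1) (frobPushBasis p e)
    (fun e => exists_sub_pow_mem_maximalIdeal p e) hf
  rw [Fintype.card_fun, Fintype.card_fin, Fintype.card_fin, pow_one,
    ← ENat.natCast_toNat (length_moduleM_ne_top p hf (e + 1)),
    ← ENat.natCast_toNat (length_moduleM_ne_top p hf e), ← Nat.cast_mul, ← Nat.cast_mul, Nat.cast_le,
    pow_succ' p n, mul_assoc] at h
  have h' := Nat.le_of_mul_le_mul_left h (Fact.out : p.Prime).pos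
  have h'' : ((Module.length (MvPowerSeries (Fin (n + 1)) k)
      (ModuleM p f (e + 1) (p ^ (e + 1) - 1))).toNat : ℝ) ≤ (p : ℝ) ^ n *
      (Module.length (MvPowerSeries (Fin (n + 1)) k) (ModuleM p f e (p ^ e - 1))).toNat := by
    exact_mod_cast h'
  simp only [coeffC]
  have hpow : (p : ℝ) ^ ((e + 1) * n) = p ^ n * p ^ (e * n) := by ring
  rw [hpow, ← div_div]
  gcongr
  rwa [div_le_iff₀' (by positivity)]

theorem tendsto_coeffC_pow_sub_one {k : Type*} [Field k] (p : ℕ) [Fact p.Prime] [CharP k p]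
    [PerfectRing k p] {n : ℕ} {f : MvPowerSeries (Fin (n + 1)) k}
    (hf : f ∈ IsLocalRing.maximalIdeal (MvPowerSeries (Fin (n + 1)) k)) :
    Tendsto (fun e : ℕ => coeffC p f e (p ^ e - 1)) atTop (𝓝 (xi p f 1)) := by
  have hbdd : BddBelow (Set.range fun e : ℕ => coeffC p f e (p ^ e - 1)) := by
    refine ⟨0, ?_⟩
    rintro _ ⟨e, rfl⟩
    simp only [coeffC]
    positivity
  have h := tendsto_atTop_ciInf (coeffC_pow_sub_one_antitone p hf) hbdd
  have hxi : xi p f 1 = ⨅ e : ℕ, coeffC p f e (p ^ e - 1) := by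
    have : (fun e : ℕ => xiSeq p f e 1) = fun e : ℕ => coeffC p f e (p ^ e - 1) := by
      funext e
      simp [xiSeq]
    rw [xi, this, h.limsup_eq]
  rwa [hxi]

end MvPowerSeries

theorem mainTheorem3 (p : ℕ) [Fact p.Prime] (k : Type*) [Field k] [CharP k p] [PerfectField k]
    (n : ℕ) (hn : 1 ≤ n) (f : MvPowerSeries (Fin (n + 1)) k) (hf0 : f ≠ 0)
    (hf : f ∈ IsLocalRing.maximalIdeal (MvPowerSeries (Fin (n + 1)) k)) :
    haveI : CharP (MvPowerSeries (Fin (n + 1)) k ⧸ Ideal.span {f}) p :=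
      charP_quotient_span_singleton p hf
    (∀ e : ℕ,
      IsMatrixFactorization f (FrobPush.mul p e f) (FrobPush.mul p e (f ^ (p ^ e - 1))) ∧
      (∃ (v u r : ℕ) (γ : MatrixPair (MvPowerSeries (Fin (n + 1)) k) (Fin r)),
        IsMFDecomposition f (FrobPush.mul p e f) (FrobPush.mul p e (f ^ (p ^ e - 1))) v u γ) ∧
      ∀ (v u r : ℕ) (γ : MatrixPair (MvPowerSeries (Fin (n + 1)) k) (Fin r)),
        IsMFDecomposition f (FrobPush.mul p e f) (FrobPush.mul p e (f ^ (p ^ e - 1))) v u γ →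
        (v : ℕ∞) = Module.length (MvPowerSeries (Fin (n + 1)) k) (ModuleM p f e (p ^ e - 1)) ∧
        (∀ a : ℕ, IsFreeRank (MvPowerSeries (Fin (n + 1)) k ⧸ Ideal.span {f})
          (FrobPush p e (MvPowerSeries (Fin (n + 1)) k ⧸ Ideal.span {f})) a ↔ a = v) ∧
        IsGreatest {a : ℕ | HasFreeSummand (MvPowerSeries (Fin (n + 1)) k ⧸ Ideal.span {f})
          (FrobPush p e (MvPowerSeries (Fin (n + 1)) k ⧸ Ideal.span {f})) a} v) ∧
    IsFSignature p (MvPowerSeries (Fin (n + 1)) k ⧸ Ideal.span {f}) (xi p f 1) ∧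
    Tendsto (fun e : ℕ =>
        ((Module.length (MvPowerSeries (Fin (n + 1)) k) (ModuleM p f e (p ^ e - 1))).toNat : ℝ) /
          (p : ℝ) ^ (e * n))
      atTop (𝓝 (xi p f 1)) := by
  have hchar : CharP (MvPowerSeries (Fin (n + 1)) k ⧸ Ideal.span {f}) p :=
    charP_quotient_span_singleton p hf
  have hperf : PerfectRing k p := PerfectField.toPerfectRing p
  have hnt : Nontrivial (MvPowerSeries (Fin (n + 1)) k ⧸ Ideal.span {f}) :=
    CharP.nontrivial_of_char_ne_one (Fact.out : p.Prime).ne_one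
  have hloc : IsLocalRing (MvPowerSeries (Fin (n + 1)) k ⧸ Ideal.span {f}) :=
    IsLocalRing.of_surjective' _ Ideal.Quotient.mk_surjective
  have hdom : IsDomain (MvPowerSeries (Fin (n + 1)) k) := NoZeroDivisors.to_isDomain _
  have hmf (e : ℕ) :
      IsMatrixFactorization f (FrobPush.mul p e f) (FrobPush.mul p e (f ^ (p ^ e - 1))) :=
    FrobPush.isMatrixFactorization p e (MvPowerSeries.frobPushBasis p e) f
  have hlim := MvPowerSeries.tendsto_coeffC_pow_sub_one p hf
  refine ⟨fun e => ⟨hmf e, (hmf e).exists_isMFDecomposition, fun v u r γ hd => ?_⟩, ?_, hlim⟩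
  · have hfr := hd.isFreeRank hf0
    exact ⟨hd.eq_length_moduleM hf (MvPowerSeries.exists_sub_pow_mem_maximalIdeal p e),
      hfr.iff_eq, hfr.isGreatest⟩
  · refine ⟨n, ?_, fun e _ => ?_, fun a ha => ?_⟩
    · have h := ringKrullDim_quotient_span_singleton_succ_eq_ringKrullDim_of_mem_nonZeroDivisors
        (mem_nonZeroDivisors_of_ne_zero hf0) hf
      rw [MvPowerSeries.ringKrullDim_fin, Nat.cast_succ] at h
      exact ENat.WithBot.add_one_cancel.1 h
    · obtain ⟨v, u, r, γ, hd⟩ := (hmf e).exists_isMFDecomposition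
      exact ⟨v, hd.isFreeRank hf0⟩
    -- The ranks `a e` are prescribed only for `e > 0`, so the two sequences agree only eventually.
    · refine hlim.congr' ?_
      filter_upwards [eventually_gt_atTop 0] with e he
      obtain ⟨v, u, r, γ, hd⟩ := (hmf e).exists_isMFDecomposition
      rw [((hd.isFreeRank hf0).iff_eq _).1 (ha e he), coeffC,
        ← hd.eq_length_moduleM hf (MvPowerSeries.exists_sub_pow_mem_maximalIdeal p e),
        ENat.toNat_natCast]
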